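/- Let $\tau=\langle <,S;\min,\max\rangle$ be the first-order vocabulary (with equality) with a binary relation symbol $<$, a unary relation symbol $S$ and constant symbols $\min,\max$. A string $w=w_1\dots w_n\in\{0,1\}^n$ with $n\ge 1$ is identified with the $\tau$-structure with universe $\{1,\dots,n\}$, in which $<$ is the usual order, $S=\{i : w_i=1\}$, $\min=1$ and $\max=n$. A first-order $\tau$-sentence $\varphi$ separates $\mathcal A$ from $\mathcal B$ (sets of strings) if $\varphi$ is true in every $w\in\mathcal A$ and false in every $w\in\mathcal B$. The number of quantifiers of $\varphi$ is the number of occurrences of $\exists$ and $\forall$ in it. **Theorem (Many vs. All, $n$-bit).** For every integer $t\ge 2$ there is a constant $C_t$, depending only on $t$, such that the following holds. Let $f:\mathbb N\to\mathbb N$ satisfy $\lim_{n\to\infty}f(n)=\infty$. Then for every $n\ge 1$ and every set $\mathcal A\subseteq\{0,1\}^n$ with $|\mathcal A|=f(n)$ there is a first-order $\tau$-sentence that separates $\mathcal A$ from $\{0,1\}^n\setminus\mathcal A$ and has at most $$3\log_3 n+\log_t f(n)+C_t$$ quantifiers. (If $f(n)=0$, so that $\mathcal A=\emptyset$, the term $\log_t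 f(n)$ is read as $0$.) -/

import Mathlib

open FirstOrder Filter

/-- The constant symbols of the vocabulary of binary strings. -/
inductive BitStringFunc : ℕ → Type
  | minC : BitStringFunc 0
  | maxC : BitStringFunc 0

/-- The relation symbols of the vocabulary of binary strings: the order `<` and the unary
predicate `S` that marks the positions carrying a `1`. -/
inductive BitStringRel : ℕ → Type
  | lt : BitStringRel 2
  | S : BitStringRel 1

/-- The vocabulary `⟨<, S ; min, max⟩` of binary strings. -/
def bitStringLang : FirstOrder.Language where
  Functions := BitStringFunc
  Relations := BitStringRel

/-- The structure that encodes a string of `n ≥ 1` bits. Its universe is the set of positions,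
numbered `0, …, n - 1`. -/
@[reducible]
def bitStringStructure {n : ℕ} [NeZero n] (w : Fin n → Bool) :
    bitStringLang.Structure (Fin n) where
  funMap := fun {_} c _ =>
    match c with
    | BitStringFunc.minC => ⟨0, Nat.pos_of_neZero n⟩
    | BitStringFunc.maxC => ⟨n - 1, Nat.sub_one_lt (NeZero.ne n)⟩
  RelMap := fun {_} R =>
    match R with
    | BitStringRel.lt => fun x => x 0 < x 1
    | BitStringRel.S => fun x => w (x 0) = true

/-- The string `w` satisfies the first-order sentence `φ`. -/
def BitStringSatisfies {n : ℕ} [NeZero n] (w : Fin n → Bool) (φ : bitStringLang.Sentence) : Prop :=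
  letI := bitStringStructure w
  Fin n ⊨ φ

/-- The sentence `φ` separates the sets `𝒜` and `ℬ` of `n`-bit strings: it is true in every string
of `𝒜` and false in every string of `ℬ`. -/
def SeparatesBitStrings {n : ℕ} [NeZero n] (φ : bitStringLang.Sentence)
    (𝒜 ℬ : Set (Fin n → Bool)) : Prop :=
  (∀ w ∈ 𝒜, BitStringSatisfies w φ) ∧ (∀ w ∈ ℬ, ¬ BitStringSatisfies w φ)

/-- The number of occurrences of quantifiers in a first-order formula. The formulas are built from
atomic ones by `⊥`, `→` and `∀`, and `∃ x, φ` is `¬ ∀ x, ¬ φ`, so that each quantifier, existential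
or universal, is one occurrence of the constructor `all`. -/
def numQuantifiers {L : FirstOrder.Language} {α : Type*} :
    {k : ℕ} → L.BoundedFormula α k → ℕ
  | _, .falsum => 0
  | _, .equal _ _ => 0
  | _, .rel _ _ => 0
  | _, .imp φ ψ => numQuantifiers φ + numQuantifiers ψ
  | _, .all φ => numQuantifiers φ + 1

/-! Formulas with the same quantifier prefix can share it: a quantifier-free choice between them
costs no quantifier (`PrefixDefinable.ite`). To check a word on a segment whose ends are at most `3
^ (l + 1)` apart, two `∃` guess cut points and one `∀` selects which of the three pieces to check,
by being min, max or neither. All pieces continue under one prefix (`prefixDefinable_segmentReads`),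
so each factor 3 in length costs 3 quantifiers.

For a set of strings, `t` existential quantifiers fix distinct positions as labels, and `m` more,
each valued in the labels, spell an address of one of `t ^ m` strings, which is then tested under
the common prefix (`exists_prefixDefinable_mem`). Take `m = ⌈log_t f(n)⌉`; if `n < 3` or `n < t`,
name all positions instead. -/

/-- A predicate of an `n`-bit string and `k` of its positions. -/
abbrev BitPred (n k : ℕ) := (Fin n → Bool) → (Fin k → Fin n) → Prop

/-- The predicate `R` is defined by a quantifier-free formula. -/
def QFDefinable {n : ℕ} [NeZero n] {k : ℕ} (R : BitPred n k) : Prop :=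
  ∃ φ : bitStringLang.BoundedFormula Empty k, numQuantifiers φ = 0 ∧
    ∀ w v, letI := bitStringStructure w
      φ.Realize default v ↔ R w v

/-- The predicate `R` is defined by a prenex formula with the given quantifier prefix, in which
`true` stands for `∀` and `false` for `∃`. -/
def PrefixDefinable {n : ℕ} [NeZero n] : List Bool → {k : ℕ} → BitPred n k → Prop
  | [], _, R => QFDefinable R
  | true :: Q, k, R => ∃ R' : BitPred n (k + 1), PrefixDefinable Q R' ∧
      ∀ w v, R w v ↔ ∀ x, R' w (Fin.snoc v x)
  | false :: Q, k, R => ∃ R' : BitPred n (k + 1), PrefixDefinable Q R' ∧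
      ∀ w v, R w v ↔ ∃ x, R' w (Fin.snoc v x)

/-! ### Quantifier-free and prenex definability -/

section Definability

variable {n : ℕ} [NeZero n] {k : ℕ}

theorem QFDefinable.congr {R R' : BitPred n k} (h : QFDefinable R)
    (e : ∀ w v, R w v ↔ R' w v) : QFDefinable R' := by
  obtain ⟨φ, h0, h⟩ := h
  exact ⟨φ, h0, fun w v => (h w v).trans (e w v)⟩

theorem QFDefinable.false : QFDefinable (fun (_ : Fin n → Bool) (_ : Fin k → Fin n) => False) :=
  ⟨.falsum, rfl, fun _ _ => Iff.rfl⟩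

theorem QFDefinable.imp {R R' : BitPred n k} (h : QFDefinable R) (h' : QFDefinable R') :
    QFDefinable (fun w v => R w v → R' w v) := by
  obtain ⟨φ, h0, h⟩ := h
  obtain ⟨ψ, h0', h'⟩ := h'
  refine ⟨φ.imp ψ, by simp [numQuantifiers, h0, h0'], fun w v => ?_⟩
  let := bitStringStructure w
  rw [FirstOrder.Language.BoundedFormula.realize_imp]
  exact imp_congr (h w v) (h' w v)

theorem QFDefinable.not {R : BitPred n k} (h : QFDefinable R) :
    QFDefinable (fun w v => ¬ R w v) :=
  h.imp .false

theorem QFDefinable.const (p : Prop) :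
    QFDefinable (fun (_ : Fin n → Bool) (_ : Fin k → Fin n) => p) := by
  by_cases hp : p
  · exact QFDefinable.false.not.congr (by simp [hp])
  · exact QFDefinable.false.congr (by simp [hp])

theorem QFDefinable.and {R R' : BitPred n k} (h : QFDefinable R) (h' : QFDefinable R') :
    QFDefinable (fun w v => R w v ∧ R' w v) :=
  (h.imp h'.not).not.congr (fun w v => by tauto)

theorem QFDefinable.forall_finset {ι : Type*} (s : Finset ι) {R : ι → BitPred n k}
    (h : ∀ i, QFDefinable (R i)) : QFDefinable (fun w v => ∀ i ∈ s, R i w v) := by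
  classical
  induction s using Finset.induction_on with
  | empty => exact (QFDefinable.const True).congr (by simp)
  | insert a s _ ih => exact ((h a).and ih).congr (by simp)

theorem QFDefinable.forall_fintype {ι : Type*} [Fintype ι] {R : ι → BitPred n k}
    (h : ∀ i, QFDefinable (R i)) : QFDefinable (fun w v => ∀ i, R i w v) :=
  (QFDefinable.forall_finset Finset.univ h).congr (by simp)

theorem QFDefinable.exists_finset {ι : Type*} (s : Finset ι) {R : ι → BitPred n k}
    (h : ∀ i, QFDefinable (R i)) : QFDefinable (fun w v => ∃ i ∈ s, R i w v) :=
  (QFDefinable.forall_finset s fun i => (h i).not).not.congr (by simp)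

theorem QFDefinable.lt (i j : Fin k) :
    QFDefinable (fun (_ : Fin n → Bool) (v : Fin k → Fin n) => v i < v j) :=
  ⟨.rel (l := 2) BitStringRel.lt ![.var (.inr i), .var (.inr j)], rfl, fun _ _ => Iff.rfl⟩

theorem QFDefinable.eq (i j : Fin k) :
    QFDefinable (fun (_ : Fin n → Bool) (v : Fin k → Fin n) => v i = v j) :=
  ⟨.equal (.var (.inr i)) (.var (.inr j)), rfl, fun _ _ => Iff.rfl⟩

theorem QFDefinable.bit (i : Fin k) :
    QFDefinable (fun (w : Fin n → Bool) (v : Fin k → Fin n) => w (v i) = true) :=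
  ⟨.rel (l := 1) BitStringRel.S ![.var (.inr i)], rfl, fun _ _ => Iff.rfl⟩

theorem QFDefinable.bit_eq (i : Fin k) (b : Bool) :
    QFDefinable (fun (w : Fin n → Bool) (v : Fin k → Fin n) => w (v i) = b) := by
  cases b
  · exact (QFDefinable.bit i).not.congr (by simp)
  · exact QFDefinable.bit i

theorem QFDefinable.eq_min (i : Fin k) :
    QFDefinable (fun (_ : Fin n → Bool) (v : Fin k → Fin n) => (v i : ℕ) = 0) :=
  ⟨.equal (.var (.inr i)) (.func (l := 0) BitStringFunc.minC ![]), rfl, fun _ _ => Fin.ext_iff⟩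

theorem QFDefinable.eq_max (i : Fin k) :
    QFDefinable (fun (_ : Fin n → Bool) (v : Fin k → Fin n) => (v i : ℕ) = n - 1) :=
  ⟨.equal (.var (.inr i)) (.func (l := 0) BitStringFunc.maxC ![]), rfl, fun _ _ => Fin.ext_iff⟩

theorem QFDefinable.strictMono :
    QFDefinable (fun (_ : Fin n → Bool) (v : Fin k → Fin n) => StrictMono v) :=
  (QFDefinable.forall_fintype fun i => QFDefinable.forall_fintype fun j =>
    (QFDefinable.const (i < j)).imp (QFDefinable.lt i j)).congr fun _ _ => Iff.rfl

theorem numQuantifiers_mapTermRel {L L' : FirstOrder.Language} {α β : Type*} (g : ℕ → ℕ)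
    (ft : ∀ n, L.Term (α ⊕ (Fin n)) → L'.Term (β ⊕ (Fin (g n))))
    (fr : ∀ n, L.Relations n → L'.Relations n)
    (h : ∀ n, L'.BoundedFormula β (g (n + 1)) → L'.BoundedFormula β (g n + 1))
    (hh : ∀ n φ, numQuantifiers (h n φ) = numQuantifiers φ)
    {k : ℕ} (φ : L.BoundedFormula α k) :
    numQuantifiers (φ.mapTermRel ft fr h) = numQuantifiers φ := by
  induction φ with
  | falsum => rfl
  | equal => rfl
  | rel => rfl
  | imp _ _ h1 h2 =>
    simp only [FirstOrder.Language.BoundedFormula.mapTermRel, numQuantifiers, h1, h2]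
  | all _ h1 => simp only [FirstOrder.Language.BoundedFormula.mapTermRel, numQuantifiers, hh, h1]

theorem numQuantifiers_castLE {L : FirstOrder.Language} {α : Type*} {k m : ℕ} (h : k ≤ m)
    (φ : L.BoundedFormula α k) : numQuantifiers (φ.castLE h) = numQuantifiers φ := by
  induction φ generalizing m with
  | falsum => rfl
  | equal => rfl
  | rel => rfl
  | imp _ _ h1 h2 =>
    simp only [FirstOrder.Language.BoundedFormula.castLE, numQuantifiers, h1, h2]
  | all _ h1 => simp only [FirstOrder.Language.BoundedFormula.castLE, numQuantifiers, h1]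

theorem QFDefinable.comp_castSucc {R : BitPred n k} (h : QFDefinable R) :
    QFDefinable (fun (w : Fin n → Bool) (v : Fin (k + 1) → Fin n) =>
      R w (fun i => v i.castSucc)) := by
  obtain ⟨φ, h0, h⟩ := h
  refine ⟨φ.liftAt 1 k, ?_, fun w v => ?_⟩
  · rw [← h0]
    exact numQuantifiers_mapTermRel _ _ _ _ (fun _ _ => numQuantifiers_castLE _ _) _
  · let := bitStringStructure w
    rw [FirstOrder.Language.BoundedFormula.realize_liftAt_one_self]
    exact h w _

theorem PrefixDefinable.congr {Q : List Bool} {R R' : BitPred n k} (h : PrefixDefinable Q R)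
    (e : ∀ w v, R w v ↔ R' w v) : PrefixDefinable Q R' := by
  have : R = R' := by
    funext w v
    exact propext (e w v)
  exact this ▸ h

theorem PrefixDefinable.all {Q : List Bool} {R : BitPred n (k + 1)} (h : PrefixDefinable Q R) :
    PrefixDefinable (true :: Q) (fun w (v : Fin k → Fin n) => ∀ x, R w (Fin.snoc v x)) :=
  ⟨R, h, fun _ _ => Iff.rfl⟩

theorem PrefixDefinable.ex {Q : List Bool} {R : BitPred n (k + 1)} (h : PrefixDefinable Q R) :
    PrefixDefinable (false :: Q) (fun w (v : Fin k → Fin n) => ∃ x, R w (Fin.snoc v x)) :=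
  ⟨R, h, fun _ _ => Iff.rfl⟩

/-- The universe is nonempty, so vacuous quantifiers are harmless; this pads trivial branches to a
common prefix. -/
theorem PrefixDefinable.const (Q : List Bool) (p : Prop) :
    PrefixDefinable Q (fun (_ : Fin n → Bool) (_ : Fin k → Fin n) => p) := by
  induction Q generalizing k with
  | nil => exact QFDefinable.const p
  | cons b Q ih =>
    cases b
    · exact (ih (k := k + 1)).ex.congr (by simp)
    · exact (ih (k := k + 1)).all.congr (by simp)

open Classical in
/-- A case distinction by a quantifier-free condition does not lengthen the prefix. -/
theorem PrefixDefinable.ite {Q : List Bool} {c R R' : BitPred n k} (hc : QFDefinable c)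
    (h : PrefixDefinable Q R) (h' : PrefixDefinable Q R') :
    PrefixDefinable Q (fun w v => if c w v then R w v else R' w v) := by
  induction Q generalizing k with
  | nil =>
    refine ((hc.imp h).and (hc.not.imp h')).congr fun w v => ?_
    by_cases hcv : c w v <;> simp [hcv]
  | cons b Q ih =>
    cases b
    all_goals
      obtain ⟨T, hT, e⟩ := h
      obtain ⟨T', hT', e'⟩ := h'
      -- The condition ignores the new variable, so it can be moved under the quantifier.
      refine ⟨_, ih hc.comp_castSucc hT hT', fun w v => ?_⟩
      simp only [Fin.snoc_castSucc]
      by_cases hcv : c w v <;> simp [hcv, e, e']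

theorem PrefixDefinable.and_left {Q : List Bool} {c R : BitPred n k} (hc : QFDefinable c)
    (h : PrefixDefinable Q R) : PrefixDefinable Q (fun w v => c w v ∧ R w v) := by
  classical
  refine (PrefixDefinable.ite hc h (.const Q False)).congr fun w v => ?_
  by_cases hcv : c w v <;> simp [hcv]

theorem PrefixDefinable.exists_block {Q : List Bool} {m : ℕ} {R : BitPred n m}
    (h : PrefixDefinable Q R) :
    PrefixDefinable (List.replicate m false ++ Q)
      (fun w (_ : Fin 0 → Fin n) => ∃ v, R w v) := by
  induction m generalizing Q with
  | zero =>
    refine PrefixDefinable.congr (Q := Q) h fun w v => ⟨fun hv => ⟨v, hv⟩, ?_⟩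
    rintro ⟨v', hv'⟩
    rwa [Subsingleton.elim v v']
  | succ m ih =>
    have := ih h.ex
    rw [List.replicate_succ', List.append_assoc]
    refine this.congr fun w _ => ⟨?_, ?_⟩
    · rintro ⟨v, x, hv⟩
      exact ⟨_, hv⟩
    · rintro ⟨v, hv⟩
      exact ⟨Fin.init v, v (Fin.last m), by rwa [Fin.snoc_init_self]⟩

theorem PrefixDefinable.exists_formula {Q : List Bool} {R : BitPred n k}
    (h : PrefixDefinable Q R) :
    ∃ φ : bitStringLang.BoundedFormula Empty k, numQuantifiers φ = Q.length ∧
      ∀ w v, letI := bitStringStructure w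
        φ.Realize default v ↔ R w v := by
  induction Q generalizing k with
  | nil => exact h
  | cons b Q ih =>
    cases b
    all_goals
      obtain ⟨T, hT, e⟩ := h
      obtain ⟨φ, hφ, hr⟩ := ih hT
    · refine ⟨φ.ex, ?_, fun w v => ?_⟩
      · simp [numQuantifiers, hφ]
      · let := bitStringStructure w
        rw [e, FirstOrder.Language.BoundedFormula.realize_ex]
        exact exists_congr fun x => hr w _
    · refine ⟨φ.all, by simp [numQuantifiers, hφ], fun w v => ?_⟩
      let := bitStringStructure w
      rw [e, FirstOrder.Language.BoundedFormula.realize_all]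
      exact forall_congr' fun x => hr w _

theorem PrefixDefinable.exists_separating {Q : List Bool} {𝒜 : Finset (Fin n → Bool)}
    (h : PrefixDefinable Q (fun w (_ : Fin 0 → Fin n) => w ∈ 𝒜)) :
    ∃ φ : bitStringLang.Sentence,
      SeparatesBitStrings φ (𝒜 : Set (Fin n → Bool)) (𝒜 : Set (Fin n → Bool))ᶜ ∧
      numQuantifiers φ = Q.length := by
  obtain ⟨φ, hφ, hr⟩ := h.exists_formula
  have key : ∀ w, BitStringSatisfies w φ ↔ w ∈ 𝒜 := fun w => by
    rw [← hr w default]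
    unfold BitStringSatisfies FirstOrder.Language.Sentence.Realize
      FirstOrder.Language.Formula.Realize
    exact iff_of_eq (congrArg₂ _ (Subsingleton.elim _ _) (Subsingleton.elim _ _))
  exact ⟨φ, ⟨fun w hw => (key w).2 hw, fun w hw hs => hw ((key w).1 hs)⟩, hφ⟩

end Definability

/-! ### Defining one string by ternary splitting -/

section Segments

variable {n : ℕ}

/-- The positions from `a` to `b` carry the word `u 0, …, u d`, and `b = a + d`. -/
def SegmentReads (w : Fin n → Bool) (a b : Fin n) (d : ℕ) (u : ℕ → Bool) : Prop :=
  (b : ℕ) = a + d ∧ ∀ p : Fin n, a ≤ p → p ≤ b → w p = u (p - a)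

theorem segmentReads_zero {w : Fin n → Bool} {a b : Fin n} {u : ℕ → Bool} :
    SegmentReads w a b 0 u ↔ a = b ∧ w a = u 0 := by
  constructor
  · rintro ⟨h1, h2⟩
    have hab : a = b := Fin.ext (by omega)
    subst hab
    exact ⟨rfl, by simpa using h2 a le_rfl le_rfl⟩
  · rintro ⟨rfl, h⟩
    refine ⟨rfl, fun p h1 h2 => ?_⟩
    obtain rfl := le_antisymm h1 h2
    simpa using h

/-- Adjacency needs one `∀`: no position lies strictly between. This is the last quantifier of
`segmentPrefix`. -/
theorem segmentReads_one {w : Fin n → Bool} {a b : Fin n} {u : ℕ → Bool} :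
    SegmentReads w a b 1 u ↔
      ∀ z, (a < b ∧ w a = u 0 ∧ w b = u 1) ∧ ¬ (a < z ∧ z < b) := by
  constructor
  · rintro ⟨h1, h2⟩ z
    have hab : a < b := Fin.lt_def.2 (by omega)
    refine ⟨⟨hab, by simpa using h2 a le_rfl hab.le, ?_⟩, ?_⟩
    · rw [h2 b hab.le le_rfl, h1, Nat.add_sub_cancel_left]
    · rw [Fin.lt_def, Fin.lt_def]
      omega
  · intro h
    obtain ⟨⟨hab, h0, h1⟩, -⟩ := h a
    have e : (b : ℕ) = a + 1 := by
      by_contra hne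
      rw [Fin.lt_def] at hab
      have hb := b.2
      refine (h ⟨a + 1, by omega⟩).2 ⟨Fin.lt_def.2 ?_, Fin.lt_def.2 ?_⟩ <;>
        simp only <;> omega
    refine ⟨e, fun p hp hq => ?_⟩
    rw [Fin.le_def] at hp hq
    obtain hp' | hp' : (p : ℕ) = a ∨ (p : ℕ) = b := by omega
    · rw [Fin.ext hp', h0, Nat.sub_self]
    · rw [Fin.ext hp', h1, e, Nat.add_sub_cancel_left]

theorem segmentReads_add {w : Fin n → Bool} {a b : Fin n} {d e : ℕ} {u : ℕ → Bool} :
    SegmentReads w a b (d + e) u ↔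
      ∃ y, SegmentReads w a y d u ∧ SegmentReads w y b e (fun i => u (d + i)) := by
  constructor
  · rintro ⟨h1, h2⟩
    have hb := b.2
    refine ⟨⟨a + d, by omega⟩, ⟨rfl, fun p hp hq => h2 p hp ?_⟩, ⟨?_, fun p hp hq => ?_⟩⟩
    · rw [Fin.le_def] at hq ⊢
      simp only at hq
      omega
    · simp only
      omega
    · rw [Fin.le_def] at hp
      simp only at hp
      rw [h2 p (Fin.le_def.2 (by omega)) hq]
      congr 1
      simp only
      omega
  · rintro ⟨y, ⟨h1, h2⟩, ⟨h3, h4⟩⟩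
    refine ⟨by omega, fun p hp hq => ?_⟩
    by_cases hpy : p ≤ y
    · exact h2 p hp hpy
    · push Not at hpy
      rw [h4 p hpy.le hq]
      rw [Fin.lt_def] at hpy
      exact congrArg u (by omega)

/-- The prefix of the formulas that define words with at most `3 ^ l + 1` letters. -/
def segmentPrefix : ℕ → List Bool
  | 0 => [true]
  | l + 1 => false :: false :: true :: segmentPrefix l

theorem length_segmentPrefix (l : ℕ) : (segmentPrefix l).length = 3 * l + 1 := by
  induction l with
  | zero => rfl
  | succ l ih =>
    simp only [segmentPrefix, List.length_cons, ih]
    ring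

open Classical in
-- One `∀` acts as a ternary conjunction, since `3 ≤ n` makes all three cases occur.
theorem forall_three_cases (hn : 3 ≤ n) {p q r : Prop} :
    (∀ z : Fin n, if (z : ℕ) = 0 then p else if (z : ℕ) = n - 1 then q else r) ↔
      p ∧ q ∧ r := by
  constructor
  · intro h
    have h0 := h ⟨0, by omega⟩
    have h1 := h ⟨1, by omega⟩
    have h2 := h ⟨n - 1, by omega⟩
    rw [if_pos rfl] at h0
    rw [if_neg one_ne_zero, if_neg (by simp only; omega)] at h1
    rw [if_neg (by simp only; omega), if_pos rfl] at h2
    exact ⟨h0, h2, h1⟩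
  · rintro ⟨hp, hq, hr⟩ z
    split_ifs <;> assumption

variable [NeZero n] {k : ℕ}

theorem prefixDefinable_segmentReads (l : ℕ) (hn : 3 ≤ n) (d : ℕ) (hd : d ≤ 3 ^ l)
    (u : ℕ → Bool) (i j : Fin k) :
    PrefixDefinable (segmentPrefix l)
      (fun w (v : Fin k → Fin n) => SegmentReads w (v i) (v j) d u) := by
  classical
  induction l generalizing k d u with
  | zero =>
    obtain rfl | rfl : d = 0 ∨ d = 1 := by
      rw [pow_zero] at hd
      omega
    · refine (PrefixDefinable.all (Q := []) (k := k)
        ((QFDefinable.eq i.castSucc j.castSucc).and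
          (QFDefinable.bit_eq i.castSucc (u 0)))).congr fun w v => ?_
      simp [segmentReads_zero]
    · refine (PrefixDefinable.all (Q := []) (k := k)
        (((QFDefinable.lt i.castSucc j.castSucc).and
          ((QFDefinable.bit_eq i.castSucc (u 0)).and (QFDefinable.bit_eq j.castSucc (u 1)))).and
          ((QFDefinable.lt i.castSucc (Fin.last k)).and
            (QFDefinable.lt (Fin.last k) j.castSucc)).not)).congr fun w v => ?_
      simp only [segmentReads_one, Fin.snoc_castSucc, Fin.snoc_last]
  | succ l ih =>
    obtain ⟨d₁, d₂, d₃, rfl, h₁, h₂, h₃⟩ :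
        ∃ d₁ d₂ d₃, d = d₁ + (d₂ + d₃) ∧ d₁ ≤ 3 ^ l ∧ d₂ ≤ 3 ^ l ∧ d₃ ≤ 3 ^ l := by
      rw [pow_succ] at hd
      -- Greedy cut; later pieces may have length 0, which the base case allows.
      exact ⟨min d (3 ^ l), min (d - 3 ^ l) (3 ^ l), d - 3 ^ l - 3 ^ l, by omega⟩
    let y₁ : Fin (k + 1 + 1 + 1) := (Fin.last k).castSucc.castSucc
    let y₂ : Fin (k + 1 + 1 + 1) := (Fin.last (k + 1)).castSucc
    have D₁ := ih d₁ h₁ u i.castSucc.castSucc.castSucc y₁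
    have D₂ := ih d₂ h₂ (fun e => u (d₁ + e)) y₁ y₂
    have D₃ := ih d₃ h₃ (fun e => u (d₁ + (d₂ + e))) y₂ j.castSucc.castSucc.castSucc
    refine (PrefixDefinable.ite (QFDefinable.eq_min (Fin.last (k + 1 + 1))) D₁
      (PrefixDefinable.ite (QFDefinable.eq_max (Fin.last (k + 1 + 1))) D₂
        D₃)).all.ex.ex.congr fun w v => ?_
    simp only [y₁, y₂, Fin.snoc_castSucc, Fin.snoc_last, forall_three_cases hn, segmentReads_add,
      exists_and_left]

/-- The prefix of the formulas that define single strings of length at most `3 ^ l`. -/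
def stringPrefix (l : ℕ) : List Bool := false :: false :: segmentPrefix l

theorem prefixDefinable_eq (l : ℕ) (hn : 3 ≤ n) (hl : n ≤ 3 ^ l) (w₀ : Fin n → Bool) :
    PrefixDefinable (stringPrefix l) (fun w (_ : Fin k → Fin n) => w = w₀) := by
  -- Segment ends must be variables, so two `∃` name min and max.
  let a : Fin (k + 1 + 1) := (Fin.last k).castSucc
  let b : Fin (k + 1 + 1) := Fin.last (k + 1)
  let u : ℕ → Bool := fun e => if h : e < n then w₀ ⟨e, h⟩ else false
  refine (PrefixDefinable.and_left ((QFDefinable.eq_min a).and (QFDefinable.eq_max b))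
    (prefixDefinable_segmentReads l hn (n - 1) (by omega) u a b)).ex.ex.congr fun w v => ?_
  simp only [a, b, Fin.snoc_castSucc, Fin.snoc_last]
  constructor
  · rintro ⟨x, y, ⟨hx, hy⟩, -, h⟩
    funext p
    have hp := p.2
    rw [h p (Fin.le_def.2 (by omega)) (Fin.le_def.2 (by omega))]
    simp [u, hx]
  · rintro rfl
    refine ⟨⟨0, by omega⟩, ⟨n - 1, by omega⟩, ⟨rfl, rfl⟩, by simp, fun p _ _ => ?_⟩
    simp [u]

end Segments

/-! ### Addressing many strings by labelled positions -/

section Labels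

variable {n : ℕ} [NeZero n] {k : ℕ}

open Classical in
/-- The case distinction that applies `R c` when the last variable equals the variable `y c`. -/
theorem PrefixDefinable.exists_cases {Q : List Bool} {t : ℕ} (y : Fin t → Fin k)
    {R : Fin t → BitPred n (k + 1)} (h : ∀ c, PrefixDefinable Q (R c)) (s : Finset (Fin t)) :
    ∃ T : BitPred n (k + 1), PrefixDefinable Q T ∧
      ∀ w (v : Fin k → Fin n) x, Function.Injective (v ∘ y) →
        (T w (Fin.snoc v x) ↔ ∃ c ∈ s, x = v (y c) ∧ R c w (Fin.snoc v x)) := by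
  induction s using Finset.induction_on with
  | empty => exact ⟨_, .const Q False, by simp⟩
  | insert c s hc ih =>
    obtain ⟨T, hT, e⟩ := ih
    refine ⟨_, .ite (QFDefinable.eq (Fin.last k) (y c).castSucc) (h c) hT, fun w v x hv => ?_⟩
    simp only [Fin.snoc_castSucc, Fin.snoc_last, Finset.exists_mem_insert]
    split_ifs with hx
    · constructor
      · exact fun hR => Or.inl ⟨hx, hR⟩
      · rintro (⟨-, hR⟩ | ⟨c', hc', hx', -⟩)
        · exact hR
        · have : c = c' := hv (hx.symm.trans hx')
          exact absurd (this ▸ hc') hc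
    · rw [e w v x hv]
      simp [hx]

theorem Finset.exists_eq_biUnion_card_le {α : Type*} [DecidableEq α] {t m : ℕ} (s : Finset α)
    (h : s.card ≤ t * m) :
    ∃ P : Fin t → Finset α, s = Finset.univ.biUnion P ∧ ∀ c, (P c).card ≤ m := by
  induction t generalizing s with
  | zero =>
    have : s = ∅ := by simpa using h
    exact ⟨fun _ => ∅, by simp [this], by simp⟩
  | succ t ih =>
    obtain ⟨a, ha, hac⟩ := Finset.exists_subset_card_eq (Nat.min_le_left s.card m)
    obtain ⟨P, hP, hPc⟩ := ih (s \ a) (by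
      rw [Finset.card_sdiff_of_subset ha, hac]
      rw [Nat.succ_mul] at h
      omega)
    refine ⟨Fin.cons a P, ?_, fun c => ?_⟩
    · ext x
      have hx : x ∈ s \ a ↔ ∃ c, x ∈ P c := by
        rw [hP]
        simp
      simp only [Finset.mem_biUnion, Finset.mem_univ, true_and, Fin.exists_fin_succ,
        Fin.cons_zero, Fin.cons_succ, ← hx, Finset.mem_sdiff]
      have := @ha x
      tauto
    · refine Fin.cases ?_ (fun c => ?_) c
      · simp [hac]
      · simpa using hPc c

/-- Existential quantifiers over `t` distinct positions label up to `t ^ m` strings. -/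
theorem exists_prefixDefinable_mem {Q : List Bool} {t : ℕ} (m : ℕ) (y : Fin t → Fin k)
    (hQ : ∀ (k : ℕ) (w₀ : Fin n → Bool),
      PrefixDefinable Q (fun w (_ : Fin k → Fin n) => w = w₀))
    (𝒜 : Finset (Fin n → Bool)) (h𝒜 : 𝒜.card ≤ t ^ m) :
    ∃ T : BitPred n k, PrefixDefinable (List.replicate m false ++ Q) T ∧
      ∀ w v, Function.Injective (v ∘ y) → (T w v ↔ w ∈ 𝒜) := by
  induction m generalizing k 𝒜 with
  | zero =>
    rw [pow_zero, Finset.card_le_one_iff_subset_singleton] at h𝒜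
    obtain ⟨w₀, hw₀⟩ := h𝒜
    obtain rfl | rfl := Finset.subset_singleton_iff.1 hw₀
    · exact ⟨_, .const _ False, by simp⟩
    · exact ⟨_, hQ k w₀, by simp⟩
  | succ m ih =>
    rw [pow_succ, mul_comm] at h𝒜
    obtain ⟨P, rfl, hP⟩ := Finset.exists_eq_biUnion_card_le 𝒜 h𝒜
    choose R hR hRe using fun c => ih (fun i => (y i).castSucc) (P c) (hP c)
    -- The value of the next `∃` selects the part: label `y c` leads to `P c`.
    obtain ⟨T, hT, e⟩ := PrefixDefinable.exists_cases y hR Finset.univ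
    refine ⟨_, hT.ex, fun w v hv => ?_⟩
    have hv' : ∀ x, Function.Injective
        ((Fin.snoc v x : Fin (k + 1) → Fin n) ∘ fun i => (y i).castSucc) := fun x => by
      simpa [Function.comp_def] using hv
    have hRe' := fun c x => hRe c w (Fin.snoc v x) (hv' x)
    simp only [e w v _ hv, hRe', Finset.mem_biUnion, Finset.mem_univ, true_and]
    constructor
    · rintro ⟨x, c, -, hc⟩
      exact ⟨c, hc⟩
    · rintro ⟨c, hc⟩
      exact ⟨_, c, rfl, hc⟩

theorem prefixDefinable_mem {t l : ℕ} (m : ℕ) (hn : 3 ≤ n) (hl : n ≤ 3 ^ l) (ht : t ≤ n)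
    (𝒜 : Finset (Fin n → Bool)) (h𝒜 : 𝒜.card ≤ t ^ m) :
    PrefixDefinable (List.replicate t false ++ (List.replicate m false ++ stringPrefix l))
      (fun w (_ : Fin 0 → Fin n) => w ∈ 𝒜) := by
  obtain ⟨T, hT, e⟩ := exists_prefixDefinable_mem m (id : Fin t → Fin t)
    (fun k => prefixDefinable_eq (k := k) l hn hl) 𝒜 h𝒜
  refine (PrefixDefinable.and_left QFDefinable.strictMono hT).exists_block.congr
    fun w _ => ⟨?_, fun hw => ?_⟩
  · rintro ⟨v, hv, hT⟩
    exact (e w v hv.injective).1 hT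
  -- Any `t` distinct positions would do as labels; the first `t` are taken.
  · have hv : StrictMono (Fin.castLE ht) := Fin.strictMono_castLE ht
    exact ⟨Fin.castLE ht, hv, (e w (Fin.castLE ht) hv.injective).2 hw⟩

/-- As many quantifiers as there are positions define every set of strings. -/
theorem prefixDefinable_mem_of_replicate (𝒜 : Finset (Fin n → Bool)) :
    PrefixDefinable (List.replicate n false) (fun w (_ : Fin 0 → Fin n) => w ∈ 𝒜) := by
  have h : PrefixDefinable [] (fun w (v : Fin n → Fin n) =>
      StrictMono v ∧ ∃ w₀ ∈ 𝒜, ∀ i, w (v i) = w₀ i) :=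
    QFDefinable.strictMono.and (QFDefinable.exists_finset 𝒜 fun w₀ =>
      QFDefinable.forall_fintype fun i => QFDefinable.bit_eq i (w₀ i))
  have h' := h.exists_block
  rw [List.append_nil] at h'
  refine h'.congr fun w _ => ⟨?_, fun hw => ⟨id, strictMono_id, w, hw, fun _ => rfl⟩⟩
  rintro ⟨v, hv, w₀, hw₀, e⟩
  -- The only order automorphism of `Fin n` is the identity.
  have hid : v = id := by
    have hb := Finite.injective_iff_bijective.1 hv.injective
    have := Subsingleton.elim (hv.orderIsoOfSurjective v hb.2) (OrderIso.refl _)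
    funext i
    exact congrArg (fun g : Fin n ≃o Fin n => g i) this
  have : w = w₀ := funext fun i => by simpa [hid] using e i
  exact this ▸ hw₀

end Labels

/-! ### Counting quantifiers -/

theorem Nat.cast_clog_le_logb_add_one (b m : ℕ) (hb : 2 ≤ b) :
    (Nat.clog b m : ℝ) ≤ Real.logb b m + 1 := by
  rw [← Real.natCeil_logb_natCast]
  refine (Nat.ceil_lt_add_one ?_).le
  rcases Nat.eq_zero_or_pos m with rfl | hm
  · simp
  · exact Real.logb_nonneg (by exact_mod_cast hb) (by exact_mod_cast hm)

theorem mainTheorem11 (t : ℕ) (ht : 2 ≤ t) :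
    ∃ C : ℝ, ∀ f : ℕ → ℕ, Tendsto f atTop atTop →
      ∀ (n : ℕ) [NeZero n] (𝒜 : Finset (Fin n → Bool)), 𝒜.card = f n →
        ∃ φ : bitStringLang.Sentence,
          SeparatesBitStrings φ (𝒜 : Set (Fin n → Bool)) (𝒜 : Set (Fin n → Bool))ᶜ ∧
          (numQuantifiers φ : ℝ) ≤ 3 * Real.logb 3 n + Real.logb t (f n) + C := by
  -- `t` labels, 2 endpoints, 1 base-case `∀`, and 3 + 1 for rounding up the two logarithms.
  refine ⟨t + 7, fun f _ n _ 𝒜 h𝒜 => ?_⟩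
  have hl := Nat.cast_clog_le_logb_add_one 3 n (by norm_num)
  have hm := Nat.cast_clog_le_logb_add_one t (f n) ht
  have hl0 : (0 : ℝ) ≤ Nat.clog 3 n := Nat.cast_nonneg _
  have hm0 : (0 : ℝ) ≤ Nat.clog t (f n) := Nat.cast_nonneg _
  push_cast at hl
  by_cases hn : 3 ≤ n ∧ t ≤ n
  · obtain ⟨φ, hφ, hc⟩ := (prefixDefinable_mem (Nat.clog t (f n)) hn.1
      (Nat.le_pow_clog (by norm_num) n) hn.2 𝒜
      (h𝒜 ▸ Nat.le_pow_clog (by omega) _)).exists_separating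
    refine ⟨φ, hφ, ?_⟩
    rw [hc]
    simp only [List.length_append, List.length_replicate, stringPrefix, List.length_cons,
      length_segmentPrefix]
    push_cast
    linarith
  · obtain ⟨φ, hφ, hc⟩ := (prefixDefinable_mem_of_replicate 𝒜).exists_separating
    refine ⟨φ, hφ, ?_⟩
    have hnt : n ≤ t + 2 := by omega
    rw [hc, List.length_replicate]
    have : (n : ℝ) ≤ t + 2 := by exact_mod_cast hnt
    linarith
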